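/- Let $m,n,p,q,r,s\ge 1$ be integers. In the $m\times n$ rectangular grid of unit squares, let $(i,j)$ denote the square in the $i$-th column from the left ($1\le i\le m$) and the $j$-th row from the bottom ($1\le j\le n$). Consider the four triangular (staircase) corners, listed clockwise from the top left: $$\{i+(n+1-j)\le p\},\quad \{(m+1-i)+(n+1-j)\le q\},\quad \{(m+1-i)+j\le r\},\quad \{i+j\le s\},$$ with side lengths $p-1,q-1,r-1,s-1$. Assume that they fit into the rectangle without overlapping, i.e. $p+q\le m+2$, $r+s\le m+2$, $p+s\le n+2$, $q+r\le n+2$, $p+r\le m+n+1$ and $q+s\le m+n+1$. The Aztec octagon $\mathbb{A}_{m\times n}(p,q,r,s)$ is the rectangle with these four corners removed; it consists of $mn-\frac12(p^2-p+q^2-q+r^2-r+s^2-s)$ unit squares. Let $\alpha_{m\times n}(p,q,r,s)$ be the number of tilings of it by dominoes ($1\times 2$ and $2\times 1$ rectangles made of two adjacent squares). Define $2^k\times 2^k$ matrices $A_k$ by $A_0=\begin{bmatrix}1\end{bmatrix}$, $A_1=\begin{bmatrix}0&1\\1&0\end{bmatrix}$ and, for $k\ge 2$, $$A_k=\begin{bmatrix}\begin{bmatrix}A_{k-2}&\mathbb{O}_{k-2}\\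 \mathbb{O}_{k-2}&\mathbb{O}_{k-2}\end{bmatrix}&A_{k-1}\\ A_{k-1}&\mathbb{O}_{k-1}\end{bmatrix},$$ where $\mathbb{O}_k$ is the $2^k\times 2^k$ zero matrix, and put $$b_m(r,s)=\tfrac23\left(2^{m-r+2\lfloor r/2\rfloor}-2^{m-r}\right)+\tfrac13\left(2^{s}-2^{s-2\lfloor s/2\rfloor}\right)+1 .$$ Then $b_m(r,s)$ and $b_m(q,p)$ are integers between $1$ and $2^m$, and, with rows and columns numbered from $1$, $$\alpha_{m\times n}(p,q,r,s)=\text{the }(b_m(r,s),\,b_m(q,p))\text{-entry of }(A_m)^n .$$ -/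

import Mathlib

namespace Aztec

/-- The unit squares of the `m × n` Aztec octagon of order `(p, q, r, s)`. The square in the
`i`-th column from the left (`1 ≤ i ≤ m`) and the `j`-th row from the bottom (`1 ≤ j ≤ n`) is
`(i, j)`. From the rectangle one removes four staircase triangles, in clockwise order from the top
left corner, whose legs consist of `p - 1`, `q - 1`, `r - 1`, `s - 1` squares. -/
def octagon (m n p q r s : ℕ) : Finset (ℕ × ℕ) :=
  (Finset.Icc 1 m ×ˢ Finset.Icc 1 n).filter fun c =>
    -- not in the top left triangle `i + (n + 1 - j) ≤ p`
    p + c.2 < c.1 + (n + 1) ∧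
    -- not in the top right triangle `(m + 1 - i) + (n + 1 - j) ≤ q`
    q + c.1 + c.2 < (m + 1) + (n + 1) ∧
    -- not in the bottom right triangle `(m + 1 - i) + j ≤ r`
    r + c.1 < (m + 1) + c.2 ∧
    -- not in the bottom left triangle `i + j ≤ s`
    s < c.1 + c.2

/-- A domino: two horizontally or vertically adjacent unit squares. -/
def IsDomino (d : Finset (ℕ × ℕ)) : Prop :=
  ∃ i j : ℕ, d = {(i, j), (i + 1, j)} ∨ d = {(i, j), (i, j + 1)}

/-- `T` is a domino tiling of the region `R`: a set of dominoes contained in `R` such that every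
square of `R` lies in exactly one of them. -/
def IsDominoTiling (R : Finset (ℕ × ℕ)) (T : Finset (Finset (ℕ × ℕ))) : Prop :=
  (∀ d ∈ T, IsDomino d ∧ d ⊆ R) ∧ ∀ c ∈ R, ∃! d, d ∈ T ∧ c ∈ d

/-- The number of domino tilings of a finite region. -/
noncomputable def numDominoTilings (R : Finset (ℕ × ℕ)) : ℕ :=
  {T : Finset (Finset (ℕ × ℕ)) | IsDominoTiling R T}.ncard

/-- The `2^(k+1) × 2^(k+1)` matrix with the `2^k × 2^k` blocks `[[P, Q], [R, S]]`. -/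
def blocks {k : ℕ} (P Q R S : Matrix (Fin (2 ^ k)) (Fin (2 ^ k)) ℕ) :
    Matrix (Fin (2 ^ (k + 1))) (Fin (2 ^ (k + 1))) ℕ :=
  let e : Fin (2 ^ k) ⊕ Fin (2 ^ k) ≃ Fin (2 ^ (k + 1)) :=
    finSumFinEquiv.trans (finCongr (by rw [pow_succ, mul_two]))
  Matrix.reindex e e (Matrix.fromBlocks P Q R S)

/-- The pure-dimer transfer matrix `A_m`, of size `2^m × 2^m`. -/
def A : (m : ℕ) → Matrix (Fin (2 ^ m)) (Fin (2 ^ m)) ℕ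
  | 0 => !![1]
  | 1 => !![0, 1; 1, 0]
  | k + 2 => blocks (blocks (A k) 0 0 0) (A (k + 1)) (A (k + 1)) 0

/-- The number `b_m(r, s)`, a row or column number counted from `1`, as a rational number. The
exponents are integers, since `m - r = -1` is possible. -/
def b (m r s : ℕ) : ℚ :=
  2 / 3 * ((2 : ℚ) ^ ((m : ℤ) - r + 2 * (r / 2 : ℕ)) - (2 : ℚ) ^ ((m : ℤ) - r))
    + 1 / 3 * ((2 : ℚ) ^ (s : ℤ) - (2 : ℚ) ^ ((s : ℤ) - 2 * (s / 2 : ℕ))) + 1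

end Aztec

namespace Aztec

/-! `A m` is a transfer matrix. Encode a set of squares of a row by the binary digits of a number.
Then `A m x u` counts the ways to fill the squares of a row outside `x` by horizontal dominoes and
by vertical ones that reach up into exactly `u` (`card_tilings_row`). Hence `(A m ^ n) x t` counts
the tilings of the rectangle with `x` removed from the bottom row and `t` added above the top row
(`residual_slab`). An added square forces a vertical domino, so `t` may instead be removed from the
top row (`residual_slab_eq_card_tilings`).

The numbers `b m r s - 1` and `b m q p - 1` have alternating digits near both ends (`exists_index`).
Along each corner they remove the squares that have, in the checkerboard colouring, the colour of
its outermost diagonal. The rest of the corner then splits into forced vertical dominoes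
(`card_tilings_filter_corner`), and the octagon remains. -/

open Classical in
/-- The tilings of the finite set `R` by tiles that satisfy `D`. -/
noncomputable def tilings {α : Type*} (D : Finset α → Prop) (R : Finset α) :
    Finset (Finset (Finset α)) :=
  R.powerset.powerset.filter fun T => (∀ d ∈ T, D d ∧ d ⊆ R) ∧ ∀ c ∈ R, ∃! d, d ∈ T ∧ c ∈ d

/-! ### Counting tilings: expansion and forced tiles -/

section Tilings

variable {α : Type*} {D : Finset α → Prop} {R : Finset α} {T : Finset (Finset α)}

theorem mem_tilings :
    T ∈ tilings D R ↔ (∀ d ∈ T, D d ∧ d ⊆ R) ∧ ∀ c ∈ R, ∃! d, d ∈ T ∧ c ∈ d := by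
  classical
  simp only [tilings, Finset.mem_filter, Finset.mem_powerset, and_iff_right_iff_imp]
  exact fun h d hd => Finset.mem_powerset.2 (h.1 d hd).2

theorem insert_mem_tilings [DecidableEq α] {d : Finset α} (hd : D d) (hR : d ⊆ R)
    (hT : T ∈ tilings D (R \ d)) : insert d T ∈ tilings D R := by
  rw [mem_tilings] at hT ⊢
  have hdisj : ∀ e ∈ T, ∀ c ∈ e, c ∉ d := fun e he c hc =>
    (Finset.mem_sdiff.1 ((hT.1 e he).2 hc)).2
  refine ⟨fun e he => ?_, fun c hc => ?_⟩
  · rcases Finset.mem_insert.1 he with rfl | he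
    · exact ⟨hd, hR⟩
    · exact ⟨(hT.1 e he).1, (hT.1 e he).2.trans Finset.sdiff_subset⟩
  · by_cases hcd : c ∈ d
    · refine ⟨d, ⟨Finset.mem_insert_self _ _, hcd⟩, fun e he => ?_⟩
      rcases Finset.mem_insert.1 he.1 with h | h
      · exact h
      · exact absurd hcd (hdisj e h c he.2)
    · obtain ⟨e, he, hu⟩ := hT.2 c (Finset.mem_sdiff.2 ⟨hc, hcd⟩)
      refine ⟨e, ⟨Finset.mem_insert_of_mem he.1, he.2⟩, fun e' he' => ?_⟩
      rcases Finset.mem_insert.1 he'.1 with h | h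
      · exact absurd (h ▸ he'.2) hcd
      · exact hu e' ⟨h, he'.2⟩

theorem erase_mem_tilings [DecidableEq α] {d : Finset α} (hd : d ∈ T)
    (hT : T ∈ tilings D R) : T.erase d ∈ tilings D (R \ d) := by
  rw [mem_tilings] at hT ⊢
  have huniq : ∀ e ∈ T, ∀ c ∈ e, c ∈ d → e = d := fun e he c hc hcd =>
    (hT.2 c ((hT.1 d hd).2 hcd)).unique ⟨he, hc⟩ ⟨hd, hcd⟩
  refine ⟨fun e he => ?_, fun c hc => ?_⟩
  · rw [Finset.mem_erase] at he
    exact ⟨(hT.1 e he.2).1, fun c hc => Finset.mem_sdiff.2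
      ⟨(hT.1 e he.2).2 hc, fun hcd => he.1 (huniq e he.2 c hc hcd)⟩⟩
  · rw [Finset.mem_sdiff] at hc
    obtain ⟨e, he, hu⟩ := hT.2 c hc.1
    exact ⟨e, ⟨Finset.mem_erase.2 ⟨fun h => hc.2 (h ▸ he.2), he.1⟩, he.2⟩,
      fun e' he' => hu e' ⟨Finset.mem_of_mem_erase he'.1, he'.2⟩⟩

/-- Expansion of the number of tilings along the tile that covers a given element. -/
theorem card_tilings_eq_sum [DecidableEq α] {c : α} (hc : c ∈ R) (S : Finset (Finset α))
    (hS : ∀ d, d ∈ S ↔ D d ∧ d ⊆ R ∧ c ∈ d) :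
    (tilings D R).card = ∑ d ∈ S, (tilings D (R \ d)).card := by
  have hnot : ∀ d ∈ S, ∀ T ∈ tilings D (R \ d), ∀ e ∈ T, c ∉ e := fun d hd T hT e he hce =>
    (Finset.mem_sdiff.1 (((mem_tilings.1 hT).1 e he).2 hce)).2 ((hS d).1 hd).2.2
  have hinj : ∀ d ∈ S, Set.InjOn (insert d) (tilings D (R \ d) : Set (Finset (Finset α))) := by
    intro d hd T hT T' hT' h
    have h1 : d ∉ T := fun h => hnot d hd T hT d h ((hS d).1 hd).2.2
    have h2 : d ∉ T' := fun h => hnot d hd T' hT' d h ((hS d).1 hd).2.2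
    rw [← Finset.erase_insert h1, ← Finset.erase_insert h2, h]
  have hunion : tilings D R = S.biUnion fun d => (tilings D (R \ d)).image (insert d) := by
    ext T
    simp only [Finset.mem_biUnion, Finset.mem_image]
    constructor
    · intro hT
      obtain ⟨d, hd, -⟩ := (mem_tilings.1 hT).2 c hc
      have := (mem_tilings.1 hT).1 d hd.1
      exact ⟨d, (hS d).2 ⟨this.1, this.2, hd.2⟩, T.erase d, erase_mem_tilings hd.1 hT,
        Finset.insert_erase hd.1⟩
    · rintro ⟨d, hd, T', hT', rfl⟩
      have := (hS d).1 hd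
      exact insert_mem_tilings this.1 this.2.1 hT'
  rw [hunion, Finset.card_biUnion]
  · exact Finset.sum_congr rfl fun d hd => Finset.card_image_of_injOn (hinj d hd)
  · intro d hd d' hd' hne
    rw [Function.onFun, Finset.disjoint_left]
    intro T hT hT'
    obtain ⟨U, hU, rfl⟩ := Finset.mem_image.1 hT
    obtain ⟨U', hU', h⟩ := Finset.mem_image.1 hT'
    have : d ∈ insert d' U' := h ▸ Finset.mem_insert_self _ _
    rcases Finset.mem_insert.1 this with h | h
    · exact hne h
    · exact hnot d' hd' U' hU' d h ((hS d).1 hd).2.2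

/-- If the empty set were a tile, `{∅}` would be a second tiling. -/
theorem card_tilings_empty (hD : ¬ D ∅) : (tilings D ∅).card = 1 := by
  rw [Finset.card_eq_one]
  refine ⟨∅, Finset.ext fun T => ?_⟩
  rw [mem_tilings, Finset.mem_singleton]
  constructor
  · intro h
    refine Finset.eq_empty_of_forall_notMem fun d hd => hD ?_
    have := h.1 d hd
    rw [Finset.subset_empty.1 this.2] at this
    exact this.1
  · rintro rfl
    simp

theorem card_tilings_eq_zero {c : α} (hc : c ∈ R) (h : ∀ d, D d → d ⊆ R → c ∉ d) :
    (tilings D R).card = 0 := by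
  rw [Finset.card_eq_zero]
  refine Finset.eq_empty_of_forall_notMem fun T hT => ?_
  obtain ⟨d, hd, -⟩ := (mem_tilings.1 hT).2 c hc
  have := (mem_tilings.1 hT).1 d hd.1
  exact h d this.1 this.2 hd.2

/-- A tile that is the only one to cover some element may be removed. -/
theorem card_tilings_sdiff_of_forced [DecidableEq α] {c : α} {e : Finset α} (hD : D e)
    (he : e ⊆ R) (hc : c ∈ e) (h : ∀ d, D d → d ⊆ R → c ∈ d → d = e) :
    (tilings D R).card = (tilings D (R \ e)).card := by
  rw [card_tilings_eq_sum (he hc) {e}, Finset.sum_singleton]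
  intro d
  rw [Finset.mem_singleton]
  exact ⟨fun hd => hd ▸ ⟨hD, he, hc⟩, fun hd => h d hd.1 hd.2.1 hd.2.2⟩

/-- Expansion along an element that is covered by at most two tiles. -/
theorem card_tilings_eq_add [DecidableEq α] {c a b : α} (hc : c ∈ R) (hab : a ≠ b) (hac : a ≠ c)
    (ha : D {c, a}) (hb : D {c, b})
    (h : ∀ d, D d → d ⊆ R → c ∈ d → d = {c, a} ∨ d = {c, b}) :
    (tilings D R).card = (if a ∈ R then (tilings D (R \ {c, a})).card else 0) +
      if b ∈ R then (tilings D (R \ {c, b})).card else 0 := by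
  have hne : ({c, a} : Finset α) ≠ {c, b} := fun h => by
    have : a ∈ ({c, b} : Finset α) := h ▸ by simp
    simp [hab, hac] at this
  rw [card_tilings_eq_sum hc ((if a ∈ R then {{c, a}} else ∅) ∪ if b ∈ R then {{c, b}} else ∅),
    Finset.sum_union]
  · congr 1 <;> split_ifs <;> simp
  · split_ifs <;> simp [hne]
  · intro d
    constructor
    · intro hd
      rcases Finset.mem_union.1 hd with hd | hd <;> split_ifs at hd with hm <;>
        simp only [Finset.mem_singleton, Finset.notMem_empty] at hd <;> subst hd <;>
        simp [ha, hb, Finset.insert_subset_iff, hc, hm]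
    · rintro ⟨h1, h2, h3⟩
      rcases h d h1 h2 h3 with rfl | rfl
      · have : a ∈ R := h2 (by simp)
        simp [this]
      · have : b ∈ R := h2 (by simp)
        simp [this]

/-- A family of disjoint tiles `{c, f c}`, each of which is forced once those of smaller rank are
removed, may be removed. -/
theorem card_tilings_sdiff_of_forced_family [DecidableEq α] (f : α → α) (rank : α → ℕ)
    (C : Finset α) (hR : ∀ c ∈ C, c ∈ R ∧ f c ∈ R) (hD : ∀ c ∈ C, D {c, f c})
    (hfC : ∀ c ∈ C, f c ∉ C) (hinj : Set.InjOn f C)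
    (h : ∀ c ∈ C, ∀ d, D d → d ⊆ R → c ∈ d →
      d = {c, f c} ∨ ∃ c' ∈ C, rank c' < rank c ∧ f c' ∈ d) :
    (tilings D R).card = (tilings D (R \ (C ∪ C.image f))).card := by
  -- The tile added last has maximal rank, so all tiles that could free an alternative for it are
  -- already gone.
  induction C using Finset.induction_on_max_value rank with
  | empty => simp
  | insert a s ha hmax ih =>
    have hsub : ∀ {c}, c ∈ s → c ∈ insert a s := fun hc => Finset.mem_insert_of_mem hc
    have haa := Finset.mem_insert_self a s
    rw [ih (fun c hc => hR c (hsub hc)) (fun c hc => hD c (hsub hc))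
      (fun c hc h => hfC c (hsub hc) (hsub h)) (hinj.mono (by simp)) ?_]
    · have hset : R \ (insert a s ∪ (insert a s).image f) =
          (R \ (s ∪ s.image f)) \ {a, f a} := by
        ext x; simp only [Finset.image_insert, Finset.mem_sdiff, Finset.mem_union,
          Finset.mem_insert, Finset.mem_singleton]; tauto
      rw [hset]
      refine card_tilings_sdiff_of_forced (c := a) (hD a haa) ?_ (by simp) ?_
      · have h1 : a ∉ s.image f := fun h => by
          obtain ⟨b, hb, hba⟩ := Finset.mem_image.1 h
          exact hfC b (hsub hb) (hba ▸ haa)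
        have h2 : f a ∉ s := fun h => hfC a haa (hsub h)
        have h3 : f a ∉ s.image f := fun h => by
          obtain ⟨b, hb, hba⟩ := Finset.mem_image.1 h
          exact ha (hinj (hsub hb) haa hba ▸ hb)
        rw [Finset.insert_subset_iff, Finset.singleton_subset_iff]
        simp only [Finset.mem_sdiff, Finset.mem_union, not_or]
        exact ⟨⟨(hR a haa).1, ha, h1⟩, (hR a haa).2, h2, h3⟩
      · intro d hd hdR had
        rcases h a haa d hd (hdR.trans Finset.sdiff_subset) had with h | ⟨c, hc, hr, hcd⟩
        · exact h
        · have hcs : c ∈ s := (Finset.mem_insert.1 hc).resolve_left fun h => by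
            rw [h] at hr; exact lt_irrefl _ hr
          exact absurd (Finset.mem_union_right _ (Finset.mem_image_of_mem f hcs))
            (Finset.mem_sdiff.1 (hdR hcd)).2
    · intro c hc d hd hdR hcd
      rcases h c (hsub hc) d hd hdR hcd with h | ⟨c', hc', hr, h⟩
      · exact Or.inl h
      · refine Or.inr ⟨c', (Finset.mem_insert.1 hc').resolve_left fun h => ?_, hr, h⟩
        rw [h] at hr
        exact absurd (hmax c hc) (not_le.2 hr)

theorem card_tilings_congr {D' : Finset α → Prop} (h : ∀ d, d ⊆ R → (D d ↔ D' d)) :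
    (tilings D R).card = (tilings D' R).card := by
  congr 1
  ext T
  rw [mem_tilings, mem_tilings]
  exact and_congr_left fun _ => forall₂_congr fun d _ => and_congr_left (h d)

end Tilings

theorem numDominoTilings_eq_card_tilings (R : Finset (ℕ × ℕ)) :
    numDominoTilings R = (tilings IsDomino R).card := by
  rw [numDominoTilings, ← Set.ncard_coe_finset]
  congr 1
  ext T
  rw [Finset.mem_coe, mem_tilings]
  rfl

/-! ### Rows as binary numbers -/

/-- A domino that meets the rows up to `n`. -/
def IsLowDomino (n : ℕ) (d : Finset (ℕ × ℕ)) : Prop :=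
  IsDomino d ∧ ∃ c ∈ d, c.2 ≤ n

/-- The squares in columns `1, …, k` of row `y` that correspond to the binary digits `1` of `x`. -/
def rowCells (k y x : ℕ) : Finset (ℕ × ℕ) :=
  (Finset.Icc 1 k ×ˢ {y}).filter fun c => x.testBit (c.1 - 1) = true

/-- The squares in columns `1, …, k` of row `y` that correspond to the binary digits `0` of `x`. -/
def rowFree (k y x : ℕ) : Finset (ℕ × ℕ) :=
  (Finset.Icc 1 k ×ˢ {y}).filter fun c => x.testBit (c.1 - 1) = false

theorem mem_rowCells {k y x : ℕ} {c : ℕ × ℕ} :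
    c ∈ rowCells k y x ↔ (1 ≤ c.1 ∧ c.1 ≤ k) ∧ c.2 = y ∧ x.testBit (c.1 - 1) = true := by
  simp [rowCells, Finset.mem_product, and_assoc, -Finset.product_singleton]

theorem mem_rowFree {k y x : ℕ} {c : ℕ × ℕ} :
    c ∈ rowFree k y x ↔ (1 ≤ c.1 ∧ c.1 ≤ k) ∧ c.2 = y ∧ x.testBit (c.1 - 1) = false := by
  simp [rowFree, Finset.mem_product, and_assoc, -Finset.product_singleton]

/-- Numbers below `2 ^ (k + 1)`, split according to the digit of `2 ^ k`. -/
def topBitEquiv (k : ℕ) : Fin (2 ^ k) ⊕ Fin (2 ^ k) ≃ Fin (2 ^ (k + 1)) :=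
  finSumFinEquiv.trans (finCongr (by rw [pow_succ, mul_two]))

theorem topBitEquiv_inl (k : ℕ) (x : Fin (2 ^ k)) : (topBitEquiv k (.inl x) : ℕ) = x := rfl

theorem topBitEquiv_inr (k : ℕ) (x : Fin (2 ^ k)) : (topBitEquiv k (.inr x) : ℕ) = 2 ^ k + x :=
  rfl

theorem blocks_apply {k : ℕ} (P Q R S : Matrix (Fin (2 ^ k)) (Fin (2 ^ k)) ℕ)
    (x y : Fin (2 ^ k) ⊕ Fin (2 ^ k)) :
    blocks P Q R S (topBitEquiv k x) (topBitEquiv k y) = Matrix.fromBlocks P Q R S x y := by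
  change Matrix.reindex (topBitEquiv k) (topBitEquiv k) _ _ _ = _
  simp

theorem rowCells_inl (k y : ℕ) (x : Fin (2 ^ k)) :
    rowCells (k + 1) y (topBitEquiv k (.inl x)) = rowCells k y x := by
  ext ⟨i, j⟩
  simp only [mem_rowCells, topBitEquiv_inl]
  refine ⟨fun h => ⟨⟨h.1.1, ?_⟩, h.2⟩, fun h => ⟨⟨h.1.1, by omega⟩, h.2⟩⟩
  by_contra hi
  have : i - 1 = k := by omega
  rw [this, Nat.testBit_lt_two_pow x.2] at h
  simp at h

theorem rowFree_inl (k y : ℕ) (x : Fin (2 ^ k)) :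
    rowFree (k + 1) y (topBitEquiv k (.inl x)) = insert (k + 1, y) (rowFree k y x) := by
  ext ⟨i, j⟩
  simp only [mem_rowFree, topBitEquiv_inl, Finset.mem_insert, Prod.mk.injEq]
  by_cases hi : i = k + 1
  · subst hi
    simp [Nat.testBit_lt_two_pow x.2]
  · have : i ≤ k + 1 ↔ i ≤ k := by omega
    simp [hi, this]

theorem testBit_two_pow_add_ne {k i : ℕ} (h : i ≤ k) (h1 : 1 ≤ i) (x : ℕ) :
    (2 ^ k + x).testBit (i - 1) = x.testBit (i - 1) :=
  Nat.testBit_two_pow_add_gt (by omega) _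

theorem rowCells_inr (k y : ℕ) (x : Fin (2 ^ k)) :
    rowCells (k + 1) y (topBitEquiv k (.inr x)) = insert (k + 1, y) (rowCells k y x) := by
  ext ⟨i, j⟩
  simp only [mem_rowCells, topBitEquiv_inr, Finset.mem_insert, Prod.mk.injEq]
  by_cases hi : i = k + 1
  · subst hi
    simp [Nat.testBit_two_pow_add_eq, Nat.testBit_lt_two_pow x.2]
  · have h2 : i ≤ k + 1 ↔ i ≤ k := by omega
    simp only [h2, hi, false_and, false_or]
    exact and_congr_right fun h => by rw [testBit_two_pow_add_ne h.2 h.1]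

theorem rowFree_inr (k y : ℕ) (x : Fin (2 ^ k)) :
    rowFree (k + 1) y (topBitEquiv k (.inr x)) = rowFree k y x := by
  ext ⟨i, j⟩
  simp only [mem_rowFree, topBitEquiv_inr]
  by_cases hi : i = k + 1
  · subst hi
    simp [Nat.testBit_two_pow_add_eq, Nat.testBit_lt_two_pow x.2]
  · have h2 : i ≤ k + 1 ↔ i ≤ k := by omega
    simp only [h2]
    exact and_congr_right fun h => by rw [testBit_two_pow_add_ne h.2 h.1]

/-! ### The transfer matrix describes one row -/

/-- The upper left block of `A (k + 1)`. -/
def upperLeft : (k : ℕ) → Matrix (Fin (2 ^ k)) (Fin (2 ^ k)) ℕ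
  | 0 => 0
  | k + 1 => blocks (A k) 0 0 0

/-- The blocks correspond to the state of the last column: a horizontal domino, a vertical domino, a
square already occupied, and the impossible case of an occupied square that also sends a domino up.
Setting `upperLeft 0 = 0` makes `A 1` fit the pattern. -/
theorem A_succ (k : ℕ) : A (k + 1) = blocks (upperLeft k) (A k) (A k) 0 := by
  cases k with
  | zero => decide
  | succ k => rfl

/-- The number of tilings of `Q` without `U`, or `0` if `U` is not contained in `Q`. -/
noncomputable def residual (n : ℕ) (Q U : Finset (ℕ × ℕ)) : ℕ :=
  if U ⊆ Q then (tilings (IsLowDomino n) (Q \ U)).card else 0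

/-- Deleting `d` has no effect; it is there so that a whole vertical domino `{d, c}` is removed, as
in `card_tilings_eq_add`. -/
theorem residual_insert (n : ℕ) (Q U : Finset (ℕ × ℕ)) {c d : ℕ × ℕ} (hc : c ∉ U) (hd : d ∉ Q) :
    residual n Q (insert c U) = if c ∈ Q then residual n (Q \ {d, c}) U else 0 := by
  have hset : (Q \ {d, c}) \ U = Q \ insert c U := by
    ext x
    simp only [Finset.mem_sdiff, Finset.mem_insert, Finset.mem_singleton]
    by_cases hx : x = d
    · simp [hx, hd]
    · tauto
  by_cases hcQ : c ∈ Q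
  · have : U ⊆ Q \ {d, c} ↔ U ⊆ Q := by
      refine ⟨fun h => h.trans Finset.sdiff_subset, fun h x hx => ?_⟩
      simp only [Finset.mem_sdiff, Finset.mem_insert, Finset.mem_singleton, not_or]
      exact ⟨h hx, fun e => hd (e ▸ h hx), fun e => hc (e ▸ hx)⟩
    simp [residual, Finset.insert_subset_iff, hcQ, hset, this]
  · simp [residual, Finset.insert_subset_iff, hcQ]

theorem not_isLowDomino_empty (n : ℕ) : ¬ IsLowDomino n ∅ := by
  rintro ⟨-, c, hc, -⟩
  simp at hc

/-- The dominoes with a given rightmost lowest square. -/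
theorem isDomino_cases {d : Finset (ℕ × ℕ)} (hd : IsDomino d) {i j : ℕ} (h : (i, j) ∈ d)
    (hright : (i + 1, j) ∉ d) (hdown : ∀ j', j = j' + 1 → (i, j') ∉ d) :
    d = {(i, j), (i, j + 1)} ∨ ∃ i', i = i' + 1 ∧ d = {(i, j), (i', j)} := by
  obtain ⟨a, b, rfl | rfl⟩ := hd
  · simp only [Finset.mem_insert, Finset.mem_singleton, Prod.mk.injEq] at h
    rcases h with ⟨rfl, rfl⟩ | ⟨rfl, rfl⟩
    · simp at hright
    · exact Or.inr ⟨a, rfl, Finset.pair_comm _ _⟩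
  · simp only [Finset.mem_insert, Finset.mem_singleton, Prod.mk.injEq] at h
    rcases h with ⟨rfl, rfl⟩ | ⟨rfl, rfl⟩
    · exact Or.inl rfl
    · exact absurd (by simp) (hdown b rfl)

/-- The dominoes that meet row `y` lie in rows `y` and `y + 1`; the entries of `A k` count how they
fill the free squares of this row and which squares of the next row they cover. -/
theorem card_tilings_row {n y : ℕ} (hy : y ≤ n) (k : ℕ) :
    ∀ (x : Fin (2 ^ k)) (Q : Finset (ℕ × ℕ)), (∀ c ∈ Q, y < c.2) →
      (tilings (IsLowDomino n) (rowFree k y x ∪ Q)).card =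
        ∑ u : Fin (2 ^ k), A k x u * residual n Q (rowCells k (y + 1) u) := by
  -- A horizontal domino uses up two columns, hence strong induction; a vertical one takes a square
  -- out of `Q`, hence the general `Q`.
  induction k using Nat.strong_induction_on with
  | _ k ih =>
  intro x Q hQ
  rcases k with _ | k
  · have h1 : ∀ u, rowFree 0 y u = ∅ := fun u => by ext; simp [mem_rowFree]; omega
    have h2 : ∀ u, rowCells 0 (y + 1) u = ∅ := fun u => by ext; simp [mem_rowCells]; omega
    have h3 : ∀ u : Fin (2 ^ 0), A 0 x u = 1 := fun u => by
      rw [Fin.fin_one_eq_zero x, Fin.fin_one_eq_zero u]; rfl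
    simp [h1, h2, h3, residual]
  have hcell : ∀ u, (k + 1, y + 1) ∉ rowCells k (y + 1) u := fun u h => by
    have := (mem_rowCells.1 h).1.2; simp at this
  have hyQ : ∀ i, (i, y) ∉ Q := fun i h => lt_irrefl _ (hQ _ h)
  obtain ⟨x, rfl⟩ := (topBitEquiv k).surjective x
  rw [A_succ, ← (topBitEquiv k).sum_comp, Fintype.sum_sum_type]
  simp only [blocks_apply, rowCells_inl, rowCells_inr]
  rcases x with x | x
  · simp only [Matrix.fromBlocks_apply₁₁, Matrix.fromBlocks_apply₁₂, rowFree_inl]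
    have hfree : (k + 1, y) ∉ rowFree k y x := fun h => by
      have := (mem_rowFree.1 h).1.2; simp at this
    set R := insert (k + 1, y) (rowFree k y x) ∪ Q with hR
    have hmem : ∀ i j, (i, j) ∈ R ↔ (i = k + 1 ∧ j = y) ∨
        ((1 ≤ i ∧ i ≤ k) ∧ j = y ∧ (x : ℕ).testBit (i - 1) = false) ∨ (i, j) ∈ Q := by
      intro i j; simp [hR, mem_rowFree]
    have hlow : ∀ c ∈ R, y ≤ c.2 := by
      rintro ⟨i, j⟩ hc
      rcases (hmem i j).1 hc with h | h | h
      · exact h.2.ge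
      · exact h.2.1.ge
      · exact (hQ _ h).le
    have hup : (k + 1, y + 1) ∈ R ↔ (k + 1, y + 1) ∈ Q := by simp [hmem]
    have hleft : (k, y) ∈ R ↔ 1 ≤ k ∧ (x : ℕ).testBit (k - 1) = false := by
      simp [hmem, hyQ]
    have hsd : R \ {(k + 1, y), (k + 1, y + 1)} =
        rowFree k y x ∪ Q \ {(k + 1, y), (k + 1, y + 1)} := by
      ext ⟨i, j⟩
      simp only [Finset.mem_sdiff, hmem, Finset.mem_union, mem_rowFree, Finset.mem_insert,
        Finset.mem_singleton, Prod.mk.injEq]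
      constructor
      · rintro ⟨h | h | h, h'⟩
        · exact absurd (Or.inl h) h'
        · exact Or.inl h
        · exact Or.inr ⟨h, h'⟩
      · rintro (h | h)
        · exact ⟨Or.inr (Or.inl h), by omega⟩
        · exact ⟨Or.inr (Or.inr h.1), h.2⟩
    rw [card_tilings_eq_add (c := (k + 1, y)) (a := (k + 1, y + 1)) (b := (k, y)) (by simp [hmem])
      (by simp) (by simp) ⟨⟨k + 1, y, Or.inr rfl⟩, _, Finset.mem_insert_self _ _, hy⟩
      ⟨⟨k, y, Or.inl (Finset.pair_comm _ _)⟩, _, Finset.mem_insert_self _ _, hy⟩, add_comm]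
    · congr 1
      · rcases k with _ | k
        · simp [hleft, upperLeft]
        -- The horizontal domino fits exactly if the next digit of `x` is also `0`; this is the only
        -- nonzero block of `upperLeft`.
        · obtain ⟨x, rfl⟩ := (topBitEquiv k).surjective x
          rw [upperLeft, ← (topBitEquiv k).sum_comp, Fintype.sum_sum_type]
          simp only [blocks_apply, rowCells_inl, rowCells_inr]
          rcases x with x | x
          · have h2 : R \ {(k + 1 + 1, y), (k + 1, y)} = rowFree k y x ∪ Q := by
              ext ⟨i, j⟩
              simp only [hR, rowFree_inl, Finset.mem_sdiff, Finset.mem_union, mem_rowFree,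
                Finset.mem_insert, Finset.mem_singleton, Prod.mk.injEq]
              constructor
              · rintro ⟨(h | h | h) | h, h'⟩
                · exact absurd (Or.inl h) h'
                · exact absurd (Or.inr h) h'
                · exact Or.inl h
                · exact Or.inr h
              · rintro (h | h)
                · exact ⟨Or.inl (Or.inr (Or.inr h)), by omega⟩
                · refine ⟨Or.inr h, ?_⟩
                  have := hQ _ h
                  simp only at this
                  omega
            have h1 : (k + 1, y) ∈ R := by
              rw [hleft]; simp [topBitEquiv_inl, Nat.testBit_lt_two_pow x.2]
            rw [if_pos h1, h2, ih k (by omega) x Q hQ]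
            simp
          · have h1 : (k + 1, y) ∉ R := by
              rw [hleft]
              simp [topBitEquiv_inr, Nat.testBit_two_pow_add_eq, Nat.testBit_lt_two_pow x.2]
            rw [if_neg h1]
            simp
      · simp only [residual_insert n Q _ (hcell _) (hyQ (k + 1)), hup]
        split_ifs with h
        · rw [hsd, ih k (by omega) x _ fun c hc => hQ c (Finset.mem_sdiff.1 hc).1]
        · simp
    · intro d hd hdR hcd
      have hright : (k + 1 + 1, y) ∉ d := fun h => by
        have := (hmem _ _).1 (hdR h)
        simp [hyQ] at this
      have hdown : ∀ j', y = j' + 1 → (k + 1, j') ∉ d := fun j' hj h => by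
        have := hlow _ (hdR h)
        simp only at this
        omega
      rcases isDomino_cases hd.1 hcd hright hdown with h | ⟨i', hi, h⟩
      · exact Or.inl h
      · obtain rfl : i' = k := by omega
        exact Or.inr h
  · simp only [Matrix.fromBlocks_apply₂₁, Matrix.fromBlocks_apply₂₂, rowFree_inr]
    rw [ih k (by omega) x Q hQ]
    simp

/-! ### Powers of the transfer matrix -/

/-- The full rows `a, …, n` of width `m`, together with the squares of row `n + 1` given by `t`. -/
def slab (m n t a : ℕ) : Finset (ℕ × ℕ) :=
  Finset.Icc 1 m ×ˢ Finset.Icc a n ∪ rowCells m (n + 1) t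

theorem mem_slab {m n t a : ℕ} {c : ℕ × ℕ} : c ∈ slab m n t a ↔
    ((1 ≤ c.1 ∧ c.1 ≤ m) ∧ a ≤ c.2 ∧ c.2 ≤ n) ∨ c ∈ rowCells m (n + 1) t := by
  simp [slab]

/-- No low domino lies within row `n + 1`, so a square of `t` left over by `x` cannot be covered.
Thus the zeroth power is the identity matrix. -/
theorem residual_slab_top (m n : ℕ) (x t : Fin (2 ^ m)) :
    residual n (slab m n t (n + 1)) (rowCells m (n + 1) x) = if x = t then 1 else 0 := by
  have hs : slab m n t (n + 1) = rowCells m (n + 1) t := by simp [slab]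
  rw [hs]
  split_ifs with h
  · subst h
    simp [residual, card_tilings_empty (not_isLowDomino_empty n)]
  · rw [residual]
    split_ifs with hsub
    · have hne : (rowCells m (n + 1) t \ rowCells m (n + 1) x).Nonempty := by
        rw [Finset.sdiff_nonempty]
        intro hsub'
        refine h (Fin.ext (Nat.eq_of_testBit_eq fun l => ?_))
        by_cases hl : l < m
        · have h1 := @hsub (l + 1, n + 1)
          have h2 := @hsub' (l + 1, n + 1)
          simp only [mem_rowCells, Nat.add_sub_cancel, true_and] at h1 h2
          rw [Bool.eq_iff_iff]
          exact ⟨fun h => (h1 ⟨by omega, h⟩).2, fun h => (h2 ⟨by omega, h⟩).2⟩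
        · have hp : 2 ^ m ≤ 2 ^ l := Nat.pow_le_pow_right (by omega) (by omega)
          rw [Nat.testBit_lt_two_pow (x.2.trans_le hp), Nat.testBit_lt_two_pow (t.2.trans_le hp)]
      obtain ⟨c, hc⟩ := hne
      refine card_tilings_eq_zero hc ?_
      rintro d ⟨-, e, he, hen⟩ hd -
      have := (mem_rowCells.1 (Finset.mem_sdiff.1 (hd he)).1).2.1
      omega
    · rfl

theorem residual_slab (m n k a : ℕ) (hak : a + k = n + 1) (x t : Fin (2 ^ m)) :
    residual n (slab m n t a) (rowCells m a x) = (A m ^ k) x t := by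
  induction k generalizing a x with
  | zero =>
    obtain rfl : a = n + 1 := by omega
    rw [residual_slab_top, pow_zero, Matrix.one_apply]
  | succ k ih =>
    have hsub : rowCells m a x ⊆ slab m n t a := fun c hc => by
      rw [mem_rowCells] at hc
      exact mem_slab.2 (Or.inl ⟨hc.1, by omega⟩)
    have hset : slab m n t a \ rowCells m a x = rowFree m a x ∪ slab m n t (a + 1) := by
      ext ⟨i, j⟩
      simp only [Finset.mem_sdiff, Finset.mem_union, mem_slab, mem_rowCells, mem_rowFree,
        not_and, Bool.not_eq_true]
      constructor
      · rintro ⟨h | h, h'⟩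
        · by_cases hj : j = a
          · exact Or.inl ⟨h.1, hj, h' h.1 hj⟩
          · exact Or.inr (Or.inl ⟨h.1, by omega⟩)
        · exact Or.inr (Or.inr h)
      · rintro (h | h | h)
        · exact ⟨Or.inl ⟨h.1, by omega⟩, fun _ _ => h.2.2⟩
        · exact ⟨Or.inl ⟨h.1, by omega⟩, fun _ _ => by omega⟩
        · exact ⟨Or.inr h, fun _ _ => by omega⟩
    rw [residual, if_pos hsub, hset, card_tilings_row (by omega) m x, pow_succ', Matrix.mul_apply]
    · exact Finset.sum_congr rfl fun u _ => by rw [ih (a + 1) (by omega)]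
    · intro c hc
      rw [mem_slab, mem_rowCells] at hc
      omega

/-! ### Forced staircase corners -/

theorem IsDomino.exists_eq_pair {d : Finset (ℕ × ℕ)} (hd : IsDomino d) {i j : ℕ}
    (h : (i, j) ∈ d) : ∃ i' j', d = {(i, j), (i', j')} ∧
      ((i' = i ∧ (j' = j + 1 ∨ j = j' + 1)) ∨ (j' = j ∧ (i' = i + 1 ∨ i = i' + 1))) := by
  obtain ⟨a, b, rfl | rfl⟩ := hd <;>
    simp only [Finset.mem_insert, Finset.mem_singleton, Prod.mk.injEq] at h <;>
    rcases h with ⟨rfl, rfl⟩ | ⟨rfl, rfl⟩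
  · exact ⟨_, _, rfl, by omega⟩
  · exact ⟨_, _, Finset.pair_comm _ _, by omega⟩
  · exact ⟨_, _, rfl, by omega⟩
  · exact ⟨_, _, Finset.pair_comm _ _, by omega⟩

/-- A staircase corner whose first row has a checkerboard pattern of missing squares is tiled in
exactly one way. Here `X` and `Y` are the coordinates as seen from the corner and `g` is the step
to the next row. -/
theorem card_tilings_filter_corner (R : Finset (ℕ × ℕ)) (X Y : ℕ → ℤ) (g : ℕ → ℕ) (s M N : ℤ)
    (hX : (∀ i, X i = i) ∨ ∀ i, X i = M - i)
    (hY : (∀ j, Y j = j ∧ g j = j + 1) ∨ s ≤ N ∧ ∀ j, Y j = N - j ∧ g j = j - 1)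
    (hR : ∀ i j, X i + Y j ≤ s →
      ((i, j) ∈ R ↔ 1 ≤ X i ∧ 1 ≤ Y j ∧ ¬ (Y j = 1 ∧ (X i + 1) % 2 = s % 2))) :
    (tilings IsDomino (R.filter fun c => s < X c.1 + Y c.2)).card = (tilings IsDomino R).card := by
  -- `C` holds the corner squares of the colour opposite to the diagonal `X + Y = s`; each is paired
  -- with its neighbour in the next row.
  set C := R.filter fun c => X c.1 + Y c.2 + 1 ≤ s ∧ (X c.1 + Y c.2 + 1) % 2 = s % 2 with hC
  set f : ℕ × ℕ → ℕ × ℕ := fun c => (c.1, g c.2) with hf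
  -- When `g j = j - 1`, the bound `s ≤ N` keeps the subtraction from being truncated.
  have hg : ∀ i j, 1 ≤ X i → X i + Y j + 1 ≤ s →
      Y (g j) = Y j + 1 ∧ (g j = j + 1 ∨ j = g j + 1) := by
    intro i j h1 h2
    rcases hY with h | ⟨h0, h⟩
    · have := h j; have := h (g j); omega
    · have := h j; have := h (g j); omega
  have hYinj : ∀ j j', Y j = Y j' → j = j' := by
    intro j j' e
    rcases hY with h | ⟨-, h⟩
    · have := h j; have := h j'; omega
    · have := h j; have := h j'; omega
  have hmemC : ∀ i j, (i, j) ∈ C ↔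
      1 ≤ X i ∧ 1 ≤ Y j ∧ X i + Y j + 1 ≤ s ∧ (X i + Y j + 1) % 2 = s % 2 := by
    intro i j
    rw [hC, Finset.mem_filter]
    dsimp only
    constructor
    · rintro ⟨h, h1, h2⟩
      have := (hR i j (by omega)).1 h
      exact ⟨this.1, this.2.1, h1, h2⟩
    · rintro ⟨h1, h2, h3, h4⟩
      exact ⟨(hR i j (by omega)).2 ⟨h1, h2, by omega⟩, h3, h4⟩
  -- Squares of the diagonal's colour are missing from the first row, so each one present has a
  -- partner in the previous row.
  have hpred : ∀ i j, (i, j) ∈ R → X i + Y j ≤ s → (X i + Y j) % 2 = s % 2 →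
      ∃ j', (i, j') ∈ C ∧ g j' = j ∧ Y j' = Y j - 1 := by
    intro i j h h1 h2
    have h3 := (hR i j h1).1 h
    rcases hY with h' | ⟨h0, h'⟩
    · have e1 := h' j
      have e2 := h' (j - 1)
      exact ⟨j - 1, (hmemC _ _).2 (by omega), by omega, by omega⟩
    · have e1 := h' j
      have e2 := h' (j + 1)
      exact ⟨j + 1, (hmemC _ _).2 (by omega), by omega, by omega⟩
  have hset : (R.filter fun c => s < X c.1 + Y c.2) = R \ (C ∪ C.image f) := by
    ext ⟨i, j⟩
    rw [Finset.mem_filter, Finset.mem_sdiff, Finset.mem_union]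
    refine and_congr_right fun h => ⟨?_, ?_⟩
    · rintro hs (h1 | h1)
      · have := (hmemC i j).1 h1
        dsimp only at hs
        omega
      · obtain ⟨⟨i', j'⟩, h2, h3⟩ := Finset.mem_image.1 h1
        simp only [hf, Prod.mk.injEq] at h3
        obtain ⟨rfl, rfl⟩ := h3
        have h4 := (hmemC i' j').1 h2
        have := hg i' j' h4.1 h4.2.2.1
        dsimp only at hs
        omega
    · intro h1
      by_contra hs
      dsimp only at hs
      refine h1 ?_
      rcases Int.emod_two_eq_zero_or_one (X i + Y j + s) with hp | hp
      · obtain ⟨j', h2, rfl, -⟩ := hpred i j h (by omega) (by omega)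
        exact Or.inr (Finset.mem_image_of_mem f h2)
      · have := (hR i j (by omega)).1 h
        exact Or.inl ((hmemC i j).2 (by omega))
  rw [hset, ← card_tilings_sdiff_of_forced_family f (fun c => (Y c.2).toNat) C]
  · rintro ⟨i, j⟩ h
    refine ⟨(Finset.mem_filter.1 h).1, ?_⟩
    rw [hmemC] at h
    have := hg i j h.1 h.2.2.1
    exact (hR i (g j) (by omega)).2 (by omega)
  · rintro ⟨i, j⟩ h
    rw [hmemC] at h
    rcases (hg i j h.1 h.2.2.1).2 with e | e
    · exact ⟨i, j, Or.inr (by simp only [hf, e])⟩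
    · refine ⟨i, g j, Or.inr ?_⟩
      rw [← e]
      exact Finset.pair_comm _ _
  · rintro ⟨i, j⟩ h h'
    rw [hmemC] at h
    rw [hf] at h'
    have := (hmemC i (g j)).1 h'
    have := hg i j h.1 h.2.2.1
    omega
  · rintro ⟨i, j⟩ h ⟨i', j'⟩ h' e
    rw [Finset.mem_coe, hmemC] at h h'
    simp only [hf, Prod.mk.injEq] at e
    obtain ⟨rfl, e⟩ := e
    have h1 := hg i j h.1 h.2.2.1
    have h2 := hg i j' h'.1 h'.2.2.1
    rw [e] at h1
    rw [hYinj j j' (by omega)]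
  · rintro ⟨i, j⟩ h d hd hdR hcd
    rw [hmemC] at h
    obtain ⟨i', j', rfl, hij⟩ := hd.exists_eq_pair hcd
    have hR' : (i', j') ∈ R := hdR (by simp)
    have hcases : (i' = i ∧ (Y j' = Y j + 1 ∨ Y j' = Y j - 1)) ∨
        (Y j' = Y j ∧ (X i' = X i + 1 ∨ X i' = X i - 1)) := by
      rcases hij with ⟨rfl, e⟩ | ⟨rfl, e⟩
      · refine Or.inl ⟨rfl, ?_⟩
        rcases hY with h' | ⟨-, h'⟩
        · have := h' j; have := h' j'; omega
        · have := h' j; have := h' j'; omega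
      · refine Or.inr ⟨rfl, ?_⟩
        rcases hX with h' | h'
        · have := h' i; have := h' i'; omega
        · have := h' i; have := h' i'; omega
    have hsum : X i' + Y j' ≤ s ∧ (X i' + Y j') % 2 = s % 2 := by
      rcases hcases with ⟨rfl, e⟩ | e <;> omega
    -- Any neighbour of a square of `C` is itself the upper half of a pair, which begins in an
    -- earlier row unless it is the pair of that square.
    obtain ⟨j'', h1, rfl, h2⟩ := hpred i' j' hR' hsum.1 hsum.2
    have h3 := (hmemC _ _).1 h1
    by_cases hY' : Y j'' < Y j
    · exact Or.inr ⟨(i', j''), h1, by dsimp only; omega, by simp [hf]⟩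
    · rcases hcases with ⟨rfl, e⟩ | e
      · rw [hYinj j'' j (by omega)]
        exact Or.inl rfl
      · omega

/-! ### Binary digits of the row and column numbers -/

/-- The number with `k` binary digits `1` separated by digits `0`. -/
def altDigits : ℕ → ℕ
  | 0 => 0
  | k + 1 => 4 * altDigits k + 1

theorem three_mul_altDigits (k : ℕ) : 3 * altDigits k + 1 = 4 ^ k := by
  induction k with
  | zero => rfl
  | succ k ih => rw [altDigits, pow_succ, ← ih]; ring

theorem testBit_altDigits (k j : ℕ) :
    (altDigits k).testBit j = true ↔ j % 2 = 0 ∧ j < 2 * k := by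
  induction k generalizing j with
  | zero => simp [altDigits]
  | succ k ih =>
    have h := Nat.testBit_two_pow_mul_add (altDigits k) (show 1 < 2 ^ 2 by norm_num) j
    have h4 : 2 ^ 2 * altDigits k + 1 = altDigits (k + 1) := rfl
    rw [← h4, h]
    split_ifs with hj
    · interval_cases j
      · simp
      · simpa using (by decide : Nat.testBit 1 1 = false)
    · rw [ih]; omega

/-- Both terms of `b` are geometric sums with ratio `4`: `s / 2` alternating digits from position `s
% 2`, and `r / 2` from position `m + 1 - r`. They do not overlap because `s - 1 ≤ m + 1 - r`. -/
theorem exists_index (m r s : ℕ) (hr : 1 ≤ r) (hs : 1 ≤ s) (hrs : (r - 1) + (s - 1) ≤ m) :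
    ∃ x : Fin (2 ^ m), ((x : ℕ) : ℚ) + 1 = b m r s ∧ ∀ i, 1 ≤ i → i ≤ m →
      ((x : ℕ).testBit (i - 1) = true ↔
        (i + 1 ≤ s ∧ (i + 1) % 2 = s % 2) ∨ (m + 2 ≤ r + i ∧ (m + i) % 2 = r % 2)) := by
  have hlow : 2 ^ (s % 2) * altDigits (s / 2) < 2 ^ (m + 1 - r) := by
    have h1 : 2 * (2 ^ (s % 2) * altDigits (s / 2)) < 2 * 2 ^ (s - 1) := by
      rw [← pow_succ' 2 (s - 1), show s - 1 + 1 = s % 2 + 2 * (s / 2) by omega, pow_add, pow_mul]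
      have := three_mul_altDigits (s / 2)
      rw [mul_left_comm]
      exact Nat.mul_lt_mul_of_pos_left (by norm_num; omega) (by positivity)
    exact (Nat.lt_of_mul_lt_mul_left h1).trans_le
      (Nat.pow_le_pow_right (by omega) (by omega))
  have hbit : ∀ l, (2 ^ (m + 1 - r) * altDigits (r / 2) +
      2 ^ (s % 2) * altDigits (s / 2)).testBit l = true ↔
      (l + 2 ≤ s ∧ l % 2 = s % 2) ∨ (m + 1 ≤ r + l ∧ l < m ∧ (m + 1 + l) % 2 = r % 2) := by
    intro l
    rw [Nat.testBit_two_pow_mul_add _ hlow]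
    split_ifs with h
    · rw [mul_comm, Nat.testBit_mul_two_pow, Bool.and_eq_true, testBit_altDigits,
        decide_eq_true_iff]
      omega
    · rw [testBit_altDigits]
      omega
  refine ⟨⟨2 ^ (m + 1 - r) * altDigits (r / 2) + 2 ^ (s % 2) * altDigits (s / 2),
    Nat.lt_pow_two_of_testBit _ fun l hl => ?_⟩, ?_, fun i h1 h2 => ?_⟩
  · rw [← Bool.not_eq_true, hbit]
    omega
  · have e1 : (3 * altDigits (r / 2) + 1 : ℚ) = 4 ^ (r / 2) := by
      exact_mod_cast three_mul_altDigits (r / 2)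
    have e2 : (3 * altDigits (s / 2) + 1 : ℚ) = 4 ^ (s / 2) := by
      exact_mod_cast three_mul_altDigits (s / 2)
    have e3 : (2 : ℚ) ^ ((m : ℤ) - r + 2 * (r / 2 : ℕ)) = 2 ^ ((m : ℤ) - r) * 4 ^ (r / 2) := by
      rw [zpow_add₀ two_ne_zero, zpow_mul, zpow_natCast]
      norm_num
    have e4 : (2 : ℚ) ^ (m + 1 - r) = 2 * 2 ^ ((m : ℤ) - r) := by
      rw [← zpow_natCast, ← zpow_one_add₀ two_ne_zero]
      congr 1
      omega
    have e5 : (2 : ℚ) ^ ((s : ℤ) - 2 * (s / 2 : ℕ)) = 2 ^ (s % 2) := by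
      rw [← zpow_natCast 2 (s % 2)]
      congr 1
      omega
    have e6 : (2 : ℚ) ^ (s : ℤ) = 2 ^ (s % 2) * 4 ^ (s / 2) := by
      rw [zpow_natCast, show (4 : ℚ) = 2 ^ 2 by norm_num, ← pow_mul, ← pow_add]
      congr 1
      omega
    rw [b, e3, e5, e6, ← e1, ← e2]
    push_cast
    rw [e4]
    ring
  · rw [hbit]
    omega

/-! ### Cutting off the squares above the rectangle -/

/-- The squares covered from above the rectangle can be cut off together with those below them. -/
theorem residual_slab_eq_card_tilings (m n x t : ℕ) (hn : 1 ≤ n)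
    (hxt : n = 1 → ∀ i, 1 ≤ i → i ≤ m → x.testBit (i - 1) = true → t.testBit (i - 1) = false) :
    residual n (slab m n t 1) (rowCells m 1 x) =
      (tilings IsDomino ((Finset.Icc 1 m ×ˢ Finset.Icc 1 n) \
        (rowCells m 1 x ∪ rowCells m n t))).card := by
  have hsub : rowCells m 1 x ⊆ slab m n t 1 := fun c hc => by
    rw [mem_rowCells] at hc
    exact mem_slab.2 (Or.inl ⟨hc.1, by omega⟩)
  have hrow : ∀ i j, (i, j) ∈ slab m n t 1 → j ≤ n + 1 := fun i j h =>
    (mem_slab.1 h).elim (fun h => by have := h.2.2; dsimp only at this; omega)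
      fun h => (mem_rowCells.1 h).2.1.le
  set f : ℕ × ℕ → ℕ × ℕ := fun c => (c.1, c.2 - 1) with hf
  have himage : (rowCells m (n + 1) t).image f = rowCells m n t := by
    ext ⟨i, j⟩
    simp only [Finset.mem_image, mem_rowCells, hf, Prod.mk.injEq, Prod.exists]
    constructor
    · rintro ⟨i', j', ⟨h1, rfl, h2⟩, rfl, rfl⟩
      exact ⟨h1, rfl, h2⟩
    · rintro ⟨h1, rfl, h2⟩
      exact ⟨i, j + 1, ⟨h1, rfl, h2⟩, rfl, rfl⟩
  -- The rank is constant, as each of these dominoes is forced by itself: a low domino at row `n +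
  -- 1` must go down.
  rw [residual, if_pos hsub, card_tilings_sdiff_of_forced_family f (fun _ => 0)
    (rowCells m (n + 1) t), himage]
  · have hset : (slab m n t 1 \ rowCells m 1 x) \ (rowCells m (n + 1) t ∪ rowCells m n t) =
        (Finset.Icc 1 m ×ˢ Finset.Icc 1 n) \ (rowCells m 1 x ∪ rowCells m n t) := by
      ext ⟨i, j⟩
      have h1 : j ≤ n → (i, j) ∉ rowCells m (n + 1) t := fun h h' => by
        have := (mem_rowCells.1 h').2.1
        dsimp only at this
        omega
      simp only [slab, Finset.mem_sdiff, Finset.mem_union, Finset.mem_product, Finset.mem_Icc]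
      constructor
      · rintro ⟨⟨h | h, h2⟩, h3⟩
        · exact ⟨h, fun h' => h'.elim h2 fun h' => h3 (Or.inr h')⟩
        · exact absurd (Or.inl h) h3
      · rintro ⟨h, h2⟩
        exact ⟨⟨Or.inl h, fun h' => h2 (Or.inl h')⟩,
          fun h' => h'.elim (h1 h.2.2) fun h' => h2 (Or.inr h')⟩
    rw [hset]
    refine card_tilings_congr fun d hd => ⟨fun h => h.1, fun h => ⟨h, ?_⟩⟩
    have hne : d.Nonempty := by
      obtain ⟨i, j, rfl | rfl⟩ := h <;> exact Finset.insert_nonempty _ _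
    obtain ⟨c, hc⟩ := hne
    have := (Finset.mem_sdiff.1 (hd hc)).1
    rw [Finset.mem_product, Finset.mem_Icc, Finset.mem_Icc] at this
    exact ⟨c, hc, this.2.2⟩
  · rintro ⟨i, j⟩ h
    have h' := mem_rowCells.1 h
    dsimp only at h'
    refine ⟨Finset.mem_sdiff.2 ⟨mem_slab.2 (Or.inr h), fun hx => ?_⟩,
      Finset.mem_sdiff.2 ⟨mem_slab.2 (Or.inl ?_), fun hx => ?_⟩⟩
    · have := (mem_rowCells.1 hx).2.1
      dsimp only at this
      omega
    · simp only [hf]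
      omega
    · have hx' := mem_rowCells.1 hx
      simp only [hf] at hx'
      have := hxt (by omega) i h'.1.1 h'.1.2 hx'.2.2
      rw [h'.2.2] at this
      exact absurd this (by simp)
  · rintro ⟨i, j⟩ h
    have h' := (mem_rowCells.1 h).2.1
    dsimp only at h'
    refine ⟨⟨i, n, Or.inr ?_⟩, (i, n), ?_, le_rfl⟩
    · simp only [hf, h', Nat.add_sub_cancel]
      exact Finset.pair_comm _ _
    · simp [hf, h']
  · rintro ⟨i, j⟩ h h'
    have h1 := (mem_rowCells.1 h).2.1
    have h2 := (mem_rowCells.1 h').2.1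
    simp only [hf] at h1 h2
    omega
  · rintro ⟨i, j⟩ h ⟨i', j'⟩ h' e
    have h1 := (mem_rowCells.1 h).2.1
    have h2 := (mem_rowCells.1 h').2.1
    simp only [hf, Prod.mk.injEq] at e h1 h2
    rw [h1, h2, e.1]
  · rintro ⟨i, j⟩ h d ⟨hd, c, hc, hcn⟩ hdR hcd
    have h1 := (mem_rowCells.1 h).2.1
    dsimp only at h1
    subst h1
    obtain ⟨i', j', rfl, hij⟩ := hd.exists_eq_pair hcd
    have h2 := hrow i' j' (Finset.mem_sdiff.1 (hdR (by simp))).1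
    rcases Finset.mem_insert.1 hc with rfl | hc
    · dsimp only at hcn; omega
    · rw [Finset.mem_singleton] at hc
      subst hc
      dsimp only at hcn
      obtain ⟨rfl, rfl⟩ : i' = i ∧ j' = n := by omega
      exact Or.inl rfl

end Aztec

/-! ### Assembling the octagon -/

theorem theorem5 (m n p q r s : ℕ) (hm : 1 ≤ m) (hn : 1 ≤ n)
    (hp : 1 ≤ p) (hq : 1 ≤ q) (hr : 1 ≤ r) (hs : 1 ≤ s)
    -- the four triangles lie in the rectangle and are pairwise disjoint
    (hpq : (p - 1) + (q - 1) ≤ m) (hrs : (r - 1) + (s - 1) ≤ m)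
    (hps : (p - 1) + (s - 1) ≤ n) (hqr : (q - 1) + (r - 1) ≤ n)
    (hpr : p + r ≤ m + n + 1) (hqs : q + s ≤ m + n + 1) :
    -- `i`, `j` are the row and column with the numbers `b_m(r, s)`, `b_m(q, p)` counted from `1`
    ∃ i j : Fin (2 ^ m),
      ((i : ℕ) : ℚ) + 1 = Aztec.b m r s ∧
      ((j : ℕ) : ℚ) + 1 = Aztec.b m q p ∧
      Aztec.numDominoTilings (Aztec.octagon m n p q r s) = (Aztec.A m ^ n) i j := by
  obtain ⟨x, hx, hxbit⟩ := Aztec.exists_index m r s hr hs hrs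
  obtain ⟨t, ht, htbit⟩ := Aztec.exists_index m q p hq hp (by omega)
  refine ⟨x, t, hx, ht, ?_⟩
  rw [← Aztec.residual_slab m n n 1 (by omega),
    Aztec.residual_slab_eq_card_tilings m n x t hn, Aztec.numDominoTilings_eq_card_tilings]
  · set R := (Finset.Icc 1 m ×ˢ Finset.Icc 1 n) \
      (Aztec.rowCells m 1 x ∪ Aztec.rowCells m n t) with hR
    have hmem : ∀ i j, (i, j) ∈ R ↔ ((1 ≤ i ∧ i ≤ m) ∧ 1 ≤ j ∧ j ≤ n) ∧
        ¬ (j = 1 ∧ ((i + 1 ≤ s ∧ (i + 1) % 2 = s % 2) ∨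
          (m + 2 ≤ r + i ∧ (m + i) % 2 = r % 2))) ∧
        ¬ (j = n ∧ ((i + 1 ≤ p ∧ (i + 1) % 2 = p % 2) ∨
          (m + 2 ≤ q + i ∧ (m + i) % 2 = q % 2))) := by
      intro i j
      rw [hR, Finset.mem_sdiff, Finset.mem_union, Finset.mem_product, Finset.mem_Icc,
        Finset.mem_Icc, Aztec.mem_rowCells, Aztec.mem_rowCells, not_or]
      refine and_congr_right fun h => ?_
      rw [hxbit i h.1.1 h.1.2, htbit i h.1.1 h.1.2]
      simp only [h.1, and_self, true_and]
    refine .trans (.trans (.trans (.trans ?_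
      (Aztec.card_tilings_filter_corner _ (fun i => i) (fun j => (n + 1 : ℤ) - j)
        (fun j => j - 1) p 0 (n + 1) ?_ ?_ ?_))
      (Aztec.card_tilings_filter_corner _ (fun i => (m + 1 : ℤ) - i) (fun j => (n + 1 : ℤ) - j)
        (fun j => j - 1) q (m + 1) (n + 1) ?_ ?_ ?_))
      (Aztec.card_tilings_filter_corner _ (fun i => (m + 1 : ℤ) - i) (fun j => j)
        (fun j => j + 1) r (m + 1) 0 ?_ ?_ ?_))
      (Aztec.card_tilings_filter_corner R (fun i => i) (fun j => j) (fun j => j + 1) s 0 0 ?_ ?_ ?_)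
    · congr 2
      ext ⟨i, j⟩
      simp only [Aztec.octagon, Finset.mem_filter, Finset.mem_product, Finset.mem_Icc, hmem]
      omega
    all_goals first
      | exact Or.inl fun _ => rfl
      | exact Or.inr fun _ => rfl
      | exact Or.inl fun _ => ⟨rfl, rfl⟩
      | exact Or.inr ⟨by omega, fun _ => ⟨rfl, rfl⟩⟩
      -- Each removed pattern lies in its own triangle, and the triangles are disjoint, so one
      -- corner is unaffected by the others.
      | intro i j hij
        simp only [Finset.mem_filter, hmem] at hij ⊢
        omega
  -- For `n = 1` both patterns lie in the same row and are disjoint because the triangles are.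
  · intro h1 i hi him hxi
    rw [← Bool.not_eq_true, htbit i hi him]
    rw [hxbit i hi him] at hxi
    omega
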